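/- Let $\mathbb{F}$ be any field, let $n\ge 0$, and let $R=\mathbb{F}[x_1,\dots,x_n]$ with the standard grading. By a regular sequence in a polynomial ring in $n$ variables we mean a sequence of exactly $n$ homogeneous polynomials of positive degree, each of which is a non-zero-divisor modulo the ideal generated by the preceding ones; the graded quotient by the ideal generated by a regular sequence is called a complete intersection, and a quadratic complete intersection if all members of the sequence are quadratic forms. The socle of a complete intersection is the set of elements annihilated by all (classes of) variables; a socle generator is a non-zero element spanning the socle over $\mathbb{F}$. A graded $\mathbb{F}$-algebra homomorphism between two complete intersections is called an embedding if it maps a socle generator to a socle generator. Let $f_1,\dots,f_n$ be a regular sequence in $R$ such that each $f_i$ is a product of linear forms, $f_i=\ell_{i,1}\cdots\ell_{i,N_i}$. Then there exist $m\ge 0$, a regular sequence $g_1,\dots,g_m$ of quadratic forms in $\mathbb{F}[z_1,\dots,z_m]$, and an embedding $$R/\langle f_1,\dots,f_n\rangle\longrightarrow \mathbb{F}[z_1,\dots,z_m]/\langle g_1,\dots,g_m\rangle .$$ That is, Watanabe's bold conjecture (every complete intersection embeds into a quadratic complete intersection) holds for complete intersections defined by products of linear forms. -/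

import Mathlib

namespace BoldConjecture

open MvPolynomial

/-- A sequence of `n` polynomials in the polynomial ring `F[x_1, …, x_n]` in as many variables is a
(homogeneous) regular sequence: every member is homogeneous of some positive degree, and every
member is a non-zero-divisor modulo the preceding ones. -/
structure IsHomogRegularSeq {F : Type*} [Field F] {n : ℕ}
    (f : Fin n → MvPolynomial (Fin n) F) : Prop where
  homogeneous : ∀ i, ∃ d : ℕ, 0 < d ∧ (f i).IsHomogeneous d
  regular : RingTheory.Sequence.IsRegular (MvPolynomial (Fin n) F) (List.ofFn f)

/-- A sequence defining a quadratic complete intersection: a regular sequence of quadratic forms. -/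
structure IsQuadraticRegularSeq {F : Type*} [Field F] {n : ℕ}
    (f : Fin n → MvPolynomial (Fin n) F) : Prop where
  regularSeq : IsHomogRegularSeq f
  quadratic : ∀ i, (f i).IsHomogeneous 2

/-- `p` is a product of linear forms. -/
def IsProductOfLinearForms {F : Type*} [Field F] {n : ℕ} (p : MvPolynomial (Fin n) F) : Prop :=
  ∃ (N : ℕ) (l : Fin N → MvPolynomial (Fin n) F),
    (∀ j, (l j).IsHomogeneous 1) ∧ p = ∏ j, l j

/-- The quotient algebra `F[x_1, …, x_n] / ⟨f_1, …, f_n⟩`. -/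
abbrev CIQuotient {F : Type*} [Field F] {n : ℕ} (f : Fin n → MvPolynomial (Fin n) F) : Type _ :=
  MvPolynomial (Fin n) F ⧸ Ideal.span (Set.range f)

/-- The degree `d` piece of the quotient algebra, in the grading induced by the standard grading
of the polynomial ring: the classes of the homogeneous polynomials of degree `d`. -/
noncomputable def gradedPiece {F : Type*} [Field F] {n : ℕ} (f : Fin n → MvPolynomial (Fin n) F) (d : ℕ) :
    Submodule F (CIQuotient f) :=
  (homogeneousSubmodule (Fin n) F d).map
    (Ideal.Quotient.mkₐ F (Ideal.span (Set.range f))).toLinearMap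

/-- The homogeneous maximal ideal of the quotient algebra, generated by the classes of the
variables. -/
noncomputable def maxIdeal {F : Type*} [Field F] {n : ℕ} (f : Fin n → MvPolynomial (Fin n) F) :
    Ideal (CIQuotient f) :=
  Ideal.span (Set.range fun i : Fin n => Ideal.Quotient.mk (Ideal.span (Set.range f)) (X i))

/-- The socle of the quotient algebra: the elements annihilated by the homogeneous maximal ideal,
as a vector space over `F`. -/
noncomputable def socle {F : Type*} [Field F] {n : ℕ} (f : Fin n → MvPolynomial (Fin n) F) :
    Submodule F (CIQuotient f) :=
  (Submodule.annihilator (maxIdeal f)).restrictScalars F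

/-- `s` is a socle generator: the socle is one-dimensional over `F`, spanned by `s`. -/
def IsSocleGenerator {F : Type*} [Field F] {n : ℕ} (f : Fin n → MvPolynomial (Fin n) F)
    (s : CIQuotient f) : Prop :=
  s ≠ 0 ∧ socle f = Submodule.span F {s}

/-- An `F`-algebra homomorphism between two such quotients is an embedding if it preserves the
grading and maps a socle generator to a socle generator. -/
structure IsEmbedding {F : Type*} [Field F] {n m : ℕ} {f : Fin n → MvPolynomial (Fin n) F}
    {g : Fin m → MvPolynomial (Fin m) F} (φ : CIQuotient f →ₐ[F] CIQuotient g) : Prop where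
  graded : ∀ (d : ℕ), ∀ a ∈ gradedPiece f d, φ a ∈ gradedPiece g d
  socleGenerator : ∃ s : CIQuotient f, IsSocleGenerator f s ∧ IsSocleGenerator g (φ s)

end BoldConjecture

/-!
The generators can be made quadratic one linear factor at a time. Let `C` be the quotient of the
polynomial ring by all members of the sequence but one, and let that member be `q * g` with `q` a
product of two linear forms. In one more variable `y`, replace `q * g` by the quadric `y ^ 2 - q`
and by `y * g`, which has one linear factor less than `q * g`. As `C[y] / (y ^ 2 - q)` is free over
`C` with basis `1, y`, the new quotient is `C / (q * g) ⊕ (C / (g)) y`. From this description the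
new sequence is regular, the old quotient embeds, and the two socles agree: the `y`-component of a
socle element is killed by the non-zero-divisor `q`, and an element `u` of the old socle satisfies
`q * u = 0` in `C / (q * g)`, so it is a multiple of `g` and is killed by `y`
(`isSocleEmbedding_rename_succ`). A member which is itself a linear form is eliminated together with
a variable (`exists_isSocleEmbedding_of_linear`). Both steps lower the total number of linear
factors, and only quadrics are left in the end (`exists_quadratic_isSocleEmbedding`).

That the socle of the given quotient is one-dimensional is shown by a similar induction
(`hasSimpleSocle_of_products`): multiplication by `h` identifies the socles of `C / (l)` and of
`C / (l * h)`, so every product may be replaced by one of its factors; the linear forms are then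
eliminated until the field `F` is reached.

Either induction changes the members of the sequence in an arbitrary position. This is harmless
since regularity of a sequence of forms of positive degree does not depend on the order
(`isWeaklyRegular_perm`).
-/

namespace BoldConjecture

/-! ### Regular sequences as lists -/

section Regular

open RingTheory.Sequence

variable {R S : Type*} [CommRing R] [CommRing S]

theorem isWeaklyRegular_concat_iff (rs : List R) (r : R) :
    IsWeaklyRegular R (rs ++ [r]) ↔
      IsWeaklyRegular R rs ∧ ∀ x, r * x ∈ Ideal.ofList rs → x ∈ Ideal.ofList rs := by
  rw [isWeaklyRegular_append_iff, isWeaklyRegular_singleton_iff,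
    isSMulRegular_quotient_iff_mem_of_smul_mem]
  simp only [smul_eq_mul, Ideal.mul_top]

theorem map_mem_ofList_map_iff {π : R →+* S} (hπ : Function.Surjective π) {ks : List R}
    (hker : RingHom.ker π = Ideal.ofList ks) (rs : List R) (x : R) :
    π x ∈ Ideal.ofList (rs.map π) ↔ x ∈ Ideal.ofList (ks ++ rs) := by
  rw [← Ideal.map_ofList, ← Ideal.mem_comap, Ideal.comap_map_of_surjective π hπ,
    ← RingHom.ker_eq_comap_bot, hker, Ideal.ofList_append, sup_comm]

/-- A sequence that is regular modulo the kernel of a surjection maps to a regular sequence. -/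
theorem isWeaklyRegular_map_of_ker {π : R →+* S} (hπ : Function.Surjective π) {ks : List R}
    (hker : RingHom.ker π = Ideal.ofList ks) {rs : List R} (h : IsWeaklyRegular R (ks ++ rs)) :
    IsWeaklyRegular S (rs.map π) := by
  induction rs using List.reverseRecOn with
  | nil => simp
  | append_singleton rs r ih =>
    rw [← List.append_assoc, isWeaklyRegular_concat_iff] at h
    rw [List.map_append, List.map_singleton, isWeaklyRegular_concat_iff]
    refine ⟨ih h.1, fun y hy => ?_⟩
    obtain ⟨x, rfl⟩ := hπ y
    rw [← map_mul, map_mem_ofList_map_iff hπ hker] at hy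
    exact (map_mem_ofList_map_iff hπ hker rs x).2 (h.2 x hy)

theorem ofList_perm {rs rs' : List R} (h : rs.Perm rs') : Ideal.ofList rs = Ideal.ofList rs' := by
  simp only [Ideal.ofList, h.mem_iff]

end Regular

/-! ### Regular sequences of forms of positive degree -/

section Homogeneous

open RingTheory.Sequence MvPolynomial

variable {F : Type*} [Field F] {σ : Type*}

attribute [local instance] MvPolynomial.gradedAlgebra

/-- A form of positive degree. -/
def IsForm (p : MvPolynomial σ F) : Prop := ∃ d : ℕ, 0 < d ∧ p.IsHomogeneous d

theorem IsForm.mem_idealOfVars {p : MvPolynomial σ F} (hp : IsForm p) : p ∈ idealOfVars σ F := by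
  obtain ⟨d, hd, hp⟩ := hp
  rw [← pow_one (idealOfVars σ F), mem_pow_idealOfVars_iff']
  intro x hx
  exact hp.coeff_eq_zero (by omega)

theorem IsForm.mul {p q : MvPolynomial σ F} (hp : IsForm p) (hq : IsForm q) : IsForm (p * q) := by
  obtain ⟨d, hd, hp⟩ := hp
  obtain ⟨e, _, hq⟩ := hq
  exact ⟨d + e, by omega, hp.mul hq⟩

theorem isHomogeneous_ofList {rs : List (MvPolynomial σ F)} (hrs : ∀ r ∈ rs, IsForm r) :
    (Ideal.ofList rs).IsHomogeneous (homogeneousSubmodule σ F) := by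
  refine Ideal.homogeneous_span _ _ fun r hr => ?_
  obtain ⟨d, -, hd⟩ := hrs r hr
  exact ⟨d, hd⟩

/-- Graded Krull intersection: a homogeneous ideal `I` is closed for the topology given by the
powers of a form `a` of positive degree. -/
theorem mem_of_forall_sub_pow_mul_mem {I : Ideal (MvPolynomial σ F)}
    (hI : I.IsHomogeneous (homogeneousSubmodule σ F)) {a : MvPolynomial σ F} (ha : IsForm a)
    {u : MvPolynomial σ F} (hu : ∀ k : ℕ, ∃ v, u - a ^ k * v ∈ I) : u ∈ I := by
  rw [mem_iff_homogeneousComponent_mem hI]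
  intro d
  obtain ⟨v, hv⟩ := hu (d + 1)
  have h := homogeneousComponent_mem_of_mem hI hv d
  rw [map_sub] at h
  suffices homogeneousComponent d (a ^ (d + 1) * v) = 0 by simpa [this] using h
  have hm : a ^ (d + 1) * v ∈ idealOfVars σ F ^ (d + 1) :=
    Ideal.mul_mem_right _ _ (Ideal.pow_mem_pow ha.mem_idealOfVars _)
  rw [mem_pow_idealOfVars_iff'] at hm
  ext x
  rw [coeff_homogeneousComponent, coeff_zero]
  split_ifs with hx
  · exact hm x (by omega)
  · rfl

/-- Regularity of a sequence of forms of positive degree does not depend on the order. -/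
theorem isWeaklyRegular_perm {rs rs' : List (MvPolynomial σ F)} (hrs : ∀ r ∈ rs, IsForm r)
    (h : IsWeaklyRegular (MvPolynomial σ F) rs) (hp : rs.Perm rs') :
    IsWeaklyRegular (MvPolynomial σ F) rs' := by
  refine h.prototype_perm hp fun a b ts hts => ?_
  intro K hK
  have hmem : ∀ r ∈ a :: b :: ts, r ∈ rs := fun r hr => hts.subset hr
  have hI := isHomogeneous_ofList (rs := ts) fun r hr => hrs r (hmem r (by simp [hr]))
  have ha : IsForm a := hrs a (hmem a (by simp))
  have hpow : ∀ k : ℕ, ∀ z ∈ K, ∃ w ∈ K, z = a ^ k • w := by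
    intro k
    induction k with
    | zero => exact fun z hz => ⟨z, hz, by simp⟩
    | succ k ih =>
      intro z hz
      obtain ⟨w, hw, rfl⟩ := ih z hz
      rw [hK] at hw
      obtain ⟨w', hw', rfl⟩ := (Submodule.mem_smul_pointwise_iff_exists _ _ _).1 hw
      exact ⟨w', hw', by rw [pow_succ, mul_smul]⟩
  rw [eq_bot_iff]
  intro z hz
  obtain ⟨u, rfl⟩ := Submodule.Quotient.mk_surjective _ z
  rw [Submodule.mem_bot, Submodule.Quotient.mk_eq_zero, smul_eq_mul, Ideal.mul_top]
  refine mem_of_forall_sub_pow_mul_mem hI ha fun k => ?_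
  obtain ⟨w, -, hw⟩ := hpow k _ hz
  obtain ⟨v, rfl⟩ := Submodule.Quotient.mk_surjective _ w
  refine ⟨v, ?_⟩
  rw [← Submodule.Quotient.mk_smul, Submodule.Quotient.eq, smul_eq_mul, smul_eq_mul,
    Ideal.mul_top] at hw
  exact hw

end Homogeneous

/-! ### Adjoining a square root -/

section QuadraticExtension

open RingTheory.Sequence Polynomial

variable {R : Type*} [CommRing R]

theorem exists_linear_sub_mem_span [Nontrivial R] (q : R) (p : R[X]) :
    ∃ a b : R, p - (C a + C b * X) ∈ Ideal.span {(X ^ 2 - C q : R[X])} := by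
  have hm : (X ^ 2 - C q : R[X]).Monic := monic_X_pow_sub_C q two_ne_zero
  have hd : (p %ₘ (X ^ 2 - C q)).degree ≤ 1 := by
    have h := degree_modByMonic_lt p hm
    rw [degree_X_pow_sub_C two_pos] at h
    exact Order.le_of_lt_succ h
  refine ⟨(p %ₘ (X ^ 2 - C q)).coeff 0, (p %ₘ (X ^ 2 - C q)).coeff 1, ?_⟩
  rw [add_comm, ← eq_X_add_C_of_degree_le_one hd, Ideal.mem_span_singleton]
  exact ⟨p /ₘ (X ^ 2 - C q), by rw [sub_eq_iff_eq_add, add_comm, modByMonic_add_div]⟩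

/-- Modulo a monic quadratic polynomial, `1` and `X` are linearly independent over `R ⧸ I`. -/
theorem linear_mem_map_sup_span_iff (I : Ideal R) (q a b : R) :
    C a + C b * X ∈ I.map C ⊔ Ideal.span {(X ^ 2 - C q : R[X])} ↔ a ∈ I ∧ b ∈ I := by
  constructor
  · intro h
    rcases subsingleton_or_nontrivial (R ⧸ I) with hs | hn
    · rw [Ideal.Quotient.subsingleton_iff] at hs
      simp [hs]
    obtain ⟨i, hi, j, hj, hij⟩ := Submodule.mem_sup.1 h
    obtain ⟨t, rfl⟩ := Ideal.mem_span_singleton.1 hj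
    have hi0 : i.map (Ideal.Quotient.mk I) = 0 := by
      rw [← coe_mapRingHom, ← RingHom.mem_ker, ker_mapRingHom, Ideal.mk_ker]
      exact hi
    have hdvd : (X ^ 2 - C (Ideal.Quotient.mk I q)) ∣
        C (Ideal.Quotient.mk I b) * X + C (Ideal.Quotient.mk I a) := by
      have := congrArg (Polynomial.map (Ideal.Quotient.mk I)) hij
      simp only [Polynomial.map_add, hi0, Polynomial.map_mul, Polynomial.map_sub, map_C, map_X,
        Polynomial.map_pow, zero_add] at this
      exact ⟨_, by rw [this, add_comm]⟩
    have h0 : C (Ideal.Quotient.mk I b) * X + C (Ideal.Quotient.mk I a) = 0 := by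
      by_contra hne
      refine (monic_X_pow_sub_C (Ideal.Quotient.mk I q) two_ne_zero).not_dvd_of_degree_lt hne ?_
        hdvd
      rw [degree_X_pow_sub_C two_pos]
      exact lt_of_le_of_lt degree_linear_le (by norm_num)
    have ha := congrArg (fun p => coeff p 0) h0
    have hb := congrArg (fun p => coeff p 1) h0
    simp only [coeff_add, coeff_C_mul, coeff_X_zero, mul_zero, coeff_C_zero, zero_add,
      coeff_zero, coeff_X_one, mul_one, coeff_C_succ, add_zero] at ha hb
    exact ⟨Ideal.Quotient.eq_zero_iff_mem.1 ha, Ideal.Quotient.eq_zero_iff_mem.1 hb⟩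
  · rintro ⟨ha, hb⟩
    exact Ideal.mem_sup_left (add_mem (Ideal.mem_map_of_mem C ha)
      (Ideal.mul_mem_right _ _ (Ideal.mem_map_of_mem C hb)))

/-- The quotient of `R[X]` by `I`, `X ^ 2 - q` and `X * g` is `R ⧸ (I + (q * g)) ⊕ R ⧸ (I + (g))`,
with basis `1`, `X`. -/
theorem linear_mem_sup_span_X_mul_iff (I : Ideal R) (q g a b : R) :
    C a + C b * X ∈
      I.map C ⊔ Ideal.span {(X ^ 2 - C q : R[X])} ⊔ Ideal.span {(X * C g : R[X])} ↔
      a ∈ I ⊔ Ideal.span {q * g} ∧ b ∈ I ⊔ Ideal.span {g} := by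
  nontriviality R
  constructor
  · intro h
    obtain ⟨i, hi, j, hj, hij⟩ := Submodule.mem_sup.1 h
    obtain ⟨t, rfl⟩ := Ideal.mem_span_singleton.1 hj
    obtain ⟨c, d, hcd⟩ := exists_linear_sub_mem_span q t
    have key : C (a - q * g * d) + C (b - g * c) * X ∈
        I.map C ⊔ Ideal.span {(X ^ 2 - C q : R[X])} := by
      have e : C (a - q * g * d) + C (b - g * c) * X =
          i + (X * C g * (t - (C c + C d * X)) + C (g * d) * (X ^ 2 - C q)) := by
        have : i = C a + C b * X - X * C g * t := by rw [← hij]; ring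
        rw [this]
        simp only [map_sub, map_mul]
        ring
      rw [e]
      exact add_mem hi (Ideal.mem_sup_right (add_mem (Ideal.mul_mem_left _ _ hcd)
        (Ideal.mul_mem_left _ _ (Ideal.mem_span_singleton_self _))))
    obtain ⟨ha, hb⟩ := (linear_mem_map_sup_span_iff I q _ _).1 key
    exact ⟨Submodule.mem_sup.2 ⟨_, ha, q * g * d,
        Ideal.mul_mem_right _ _ (Ideal.mem_span_singleton_self _), by ring⟩,
      Submodule.mem_sup.2 ⟨_, hb, g * c,
        Ideal.mul_mem_right _ _ (Ideal.mem_span_singleton_self _), by ring⟩⟩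
  · rintro ⟨ha, hb⟩
    obtain ⟨i, hi, j, hj, rfl⟩ := Submodule.mem_sup.1 ha
    obtain ⟨d, rfl⟩ := Ideal.mem_span_singleton.1 hj
    obtain ⟨i', hi', j', hj', rfl⟩ := Submodule.mem_sup.1 hb
    obtain ⟨c, rfl⟩ := Ideal.mem_span_singleton.1 hj'
    have e : C (i + q * g * d) + C (i' + g * c) * X =
        (C i + C i' * X) + C (-(g * d)) * (X ^ 2 - C q) + X * C g * (C c + C d * X) := by
      simp only [map_add, map_mul, map_neg]
      ring
    rw [e]
    exact add_mem (Ideal.mem_sup_left (add_mem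
      (Ideal.mem_sup_left (add_mem (Ideal.mem_map_of_mem C hi)
        (Ideal.mul_mem_right _ _ (Ideal.mem_map_of_mem C hi'))))
      (Ideal.mem_sup_right (Ideal.mul_mem_left _ _ (Ideal.mem_span_singleton_self _)))))
      (Ideal.mem_sup_right (Ideal.mul_mem_right _ _ (Ideal.mem_span_singleton_self _)))

theorem mem_map_C_of_mul_mem {I : Ideal R} {r : R} (hr : ∀ x, r * x ∈ I → x ∈ I) {p : R[X]}
    (hp : C r * p ∈ I.map C) : p ∈ I.map C := by
  rw [Ideal.mem_map_C_iff] at hp ⊢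
  exact fun k => hr _ (by simpa using hp k)

theorem isWeaklyRegular_map_C {rs : List R} (h : IsWeaklyRegular R rs) :
    IsWeaklyRegular R[X] (rs.map C) := by
  induction rs using List.reverseRecOn with
  | nil => simp
  | append_singleton rs r ih =>
    rw [isWeaklyRegular_concat_iff] at h
    rw [List.map_append, List.map_singleton, isWeaklyRegular_concat_iff]
    refine ⟨ih h.1, fun p hp => ?_⟩
    rw [← Ideal.map_ofList] at hp ⊢
    exact mem_map_C_of_mul_mem h.2 hp

/-- A product `q * g` at the end of a regular sequence can be traded for `X ^ 2 - q` and `X * g`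
in one more variable. -/
theorem isWeaklyRegular_sq_sub_C_X_mul [Nontrivial R] {rs : List R} {q g : R}
    (h : IsWeaklyRegular R (rs ++ [q * g])) :
    IsWeaklyRegular R[X] (rs.map C ++ [X ^ 2 - C q] ++ [X * C g]) := by
  rw [isWeaklyRegular_concat_iff] at h
  obtain ⟨hrs, hqg⟩ := h
  have hg : ∀ x, g * x ∈ Ideal.ofList rs → x ∈ Ideal.ofList rs := fun x hx =>
    hqg x (by rw [mul_assoc]; exact Ideal.mul_mem_left _ _ hx)
  rw [isWeaklyRegular_concat_iff, isWeaklyRegular_concat_iff, Ideal.ofList_append,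
    Ideal.ofList_singleton, ← Ideal.map_ofList]
  refine ⟨⟨isWeaklyRegular_map_C hrs, fun p hp => ?_⟩, fun p hp => ?_⟩
  · have hk : (Ideal.ofList rs).map C =
        RingHom.ker (mapRingHom (Ideal.Quotient.mk (Ideal.ofList rs))) := by
      rw [ker_mapRingHom, Ideal.mk_ker]
    rw [hk, RingHom.mem_ker] at hp ⊢
    rw [map_mul] at hp
    refine ((monic_X_pow_sub_C (Ideal.Quotient.mk (Ideal.ofList rs) q)
      two_ne_zero).mul_right_eq_zero_iff).1 ?_
    simpa using hp
  · obtain ⟨a, b, hab⟩ := exists_linear_sub_mem_span q p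
    have hlin : C (q * g * b) + C (g * a) * X ∈
        (Ideal.ofList rs).map C ⊔ Ideal.span {(X ^ 2 - C q : R[X])} := by
      have e : C (q * g * b) + C (g * a) * X =
          X * C g * p - (X * C g * (p - (C a + C b * X)) + C (g * b) * (X ^ 2 - C q)) := by
        simp only [map_mul]
        ring
      rw [e]
      exact sub_mem hp (Ideal.mem_sup_right (add_mem (Ideal.mul_mem_left _ _ hab)
        (Ideal.mul_mem_left _ _ (Ideal.mem_span_singleton_self _))))
    obtain ⟨hb, ha⟩ := (linear_mem_map_sup_span_iff _ q _ _).1 hlin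
    have := add_mem ((linear_mem_map_sup_span_iff _ q _ _).2 ⟨hg a ha, hqg b hb⟩)
      (Ideal.mem_sup_right (S := (Ideal.ofList rs).map C) hab)
    simpa using this

end QuadraticExtension

/-! ### Socles of quotients of polynomial rings -/

section Socle

open RingTheory.Sequence MvPolynomial

variable {F : Type*} [Field F] {n m k : ℕ}

/-- The class of `u` modulo `I` lies in the socle of `F[x_1, …, x_n] ⧸ I`. -/
def IsSocleElement (I : Ideal (MvPolynomial (Fin n) F)) (u : MvPolynomial (Fin n) F) : Prop :=
  ∀ i, X i * u ∈ I

theorem IsSocleElement.mul_mem {I : Ideal (MvPolynomial (Fin n) F)} {u : MvPolynomial (Fin n) F}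
    (hu : IsSocleElement I u) {p : MvPolynomial (Fin n) F} (hp : p ∈ idealOfVars (Fin n) F) :
    p * u ∈ I := by
  have h : idealOfVars (Fin n) F ≤ Submodule.comap (LinearMap.mulRight _ u) I := by
    rw [idealOfVars, Ideal.span_le]
    rintro _ ⟨i, rfl⟩
    exact hu i
  exact h hp

/-- The socle of `F[x_1, …, x_n] ⧸ I` is spanned by one non-zero class. -/
def HasSimpleSocle (I : Ideal (MvPolynomial (Fin n) F)) : Prop :=
  ∃ s, s ∉ I ∧ IsSocleElement I s ∧ ∀ u, IsSocleElement I u → ∃ c : F, u - C c * s ∈ I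

/-- A homomorphism `ψ` of polynomial rings, given by linear forms, that induces an injective
homomorphism of the quotients by `I` and `J` which restricts to a bijection of their socles. -/
structure IsSocleEmbedding (I : Ideal (MvPolynomial (Fin n) F))
    (J : Ideal (MvPolynomial (Fin m) F))
    (ψ : MvPolynomial (Fin n) F →ₐ[F] MvPolynomial (Fin m) F) : Prop where
  homogeneous : ∀ i, (ψ (X i)).IsHomogeneous 1
  mem_iff : ∀ u, ψ u ∈ J ↔ u ∈ I
  socle : ∀ u, IsSocleElement I u → IsSocleElement J (ψ u)
  surj : ∀ v, IsSocleElement J v → ∃ u, IsSocleElement I u ∧ v - ψ u ∈ J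

theorem isHomogeneous_map {ψ : MvPolynomial (Fin n) F →ₐ[F] MvPolynomial (Fin m) F}
    (hψ : ∀ i, (ψ (X i)).IsHomogeneous 1) {p : MvPolynomial (Fin n) F} {d : ℕ}
    (hp : p.IsHomogeneous d) : (ψ p).IsHomogeneous d := by
  rw [aeval_unique ψ, ← one_mul d]
  exact hp.aeval _ hψ

theorem IsForm.map {ψ : MvPolynomial (Fin n) F →ₐ[F] MvPolynomial (Fin m) F}
    (hψ : ∀ i, (ψ (X i)).IsHomogeneous 1) {p : MvPolynomial (Fin n) F} (hp : IsForm p) :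
    IsForm (ψ p) := by
  obtain ⟨d, hd, hp⟩ := hp
  exact ⟨d, hd, isHomogeneous_map hψ hp⟩

theorem IsSocleEmbedding.refl (I : Ideal (MvPolynomial (Fin n) F)) :
    IsSocleEmbedding I I (AlgHom.id F _) where
  homogeneous i := isHomogeneous_X _ i
  mem_iff _ := Iff.rfl
  socle _ hu := hu
  surj v hv := ⟨v, hv, by simp⟩

theorem IsSocleEmbedding.trans {I : Ideal (MvPolynomial (Fin n) F)}
    {J : Ideal (MvPolynomial (Fin m) F)} {K : Ideal (MvPolynomial (Fin k) F)}
    {ψ : MvPolynomial (Fin n) F →ₐ[F] MvPolynomial (Fin m) F}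
    {χ : MvPolynomial (Fin m) F →ₐ[F] MvPolynomial (Fin k) F}
    (hψ : IsSocleEmbedding I J ψ) (hχ : IsSocleEmbedding J K χ) :
    IsSocleEmbedding I K (χ.comp ψ) where
  homogeneous i := isHomogeneous_map hχ.homogeneous (hψ.homogeneous i)
  mem_iff u := (hχ.mem_iff _).trans (hψ.mem_iff u)
  socle u hu := hχ.socle _ (hψ.socle u hu)
  surj w hw := by
    obtain ⟨v, hv, hwv⟩ := hχ.surj w hw
    obtain ⟨u, hu, hvu⟩ := hψ.surj v hv
    refine ⟨u, hu, ?_⟩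
    have := add_mem hwv ((hχ.mem_iff _).2 hvu)
    simpa using this

theorem IsSocleEmbedding.hasSimpleSocle {I : Ideal (MvPolynomial (Fin n) F)}
    {J : Ideal (MvPolynomial (Fin m) F)}
    {ψ : MvPolynomial (Fin n) F →ₐ[F] MvPolynomial (Fin m) F}
    (hψ : IsSocleEmbedding I J ψ) (hJ : HasSimpleSocle J) : HasSimpleSocle I := by
  obtain ⟨s, hs, hsoc, hspan⟩ := hJ
  obtain ⟨u, hu, hsu⟩ := hψ.surj s hsoc
  refine ⟨u, fun h => hs ?_, hu, fun w hw => ?_⟩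
  · simpa using add_mem hsu ((hψ.mem_iff u).2 h)
  · obtain ⟨c, hc⟩ := hspan _ (hψ.socle w hw)
    refine ⟨c, (hψ.mem_iff _).1 ?_⟩
    have e : ψ (w - C c * u) = (ψ w - C c * s) + C c * (s - ψ u) := by
      have : ψ (C c) = C c := ψ.commutes c
      rw [map_sub, map_mul, this]
      ring
    rw [e]
    exact add_mem hc (Ideal.mul_mem_left _ _ hsu)

/-- Multiplication by `h` identifies the socles modulo `I + (l)` and modulo `I + (l * h)`. -/
theorem HasSimpleSocle.mul {I : Ideal (MvPolynomial (Fin n) F)} {l h : MvPolynomial (Fin n) F}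
    (hl : l ∈ idealOfVars (Fin n) F) (hreg : ∀ x, l * h * x ∈ I → x ∈ I)
    (H : HasSimpleSocle (I ⊔ Ideal.span {l})) : HasSimpleSocle (I ⊔ Ideal.span {l * h}) := by
  have hregl : ∀ x, l * x ∈ I → x ∈ I := fun x hx => hreg x (by
    rw [mul_comm l h, mul_assoc]
    exact Ideal.mul_mem_left _ _ hx)
  have hregh : ∀ x, h * x ∈ I → x ∈ I := fun x hx => hreg x (by
    rw [mul_assoc]
    exact Ideal.mul_mem_left _ _ hx)
  have key : ∀ w, h * w ∈ I ⊔ Ideal.span {l * h} ↔ w ∈ I ⊔ Ideal.span {l} := by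
    intro w
    simp only [Ideal.mem_span_singleton, Submodule.mem_sup]
    constructor
    · rintro ⟨i, hi, _, ⟨t, rfl⟩, e⟩
      refine ⟨w - l * t, hregh _ ?_, l * t, ⟨t, rfl⟩, by ring⟩
      have : h * (w - l * t) = i := by rw [mul_sub, ← e]; ring
      rwa [this]
    · rintro ⟨i, hi, _, ⟨t, rfl⟩, rfl⟩
      exact ⟨h * i, Ideal.mul_mem_left _ _ hi, _, ⟨t, rfl⟩, by ring⟩
  obtain ⟨s, hs, hsoc, hspan⟩ := H
  refine ⟨h * s, fun hm => hs ((key s).1 hm), fun i => ?_, fun u hu => ?_⟩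
  · rw [mul_left_comm]
    exact (key _).2 (hsoc i)
  · obtain ⟨i, hi, j, hj, e⟩ := Submodule.mem_sup.1 (hu.mul_mem hl)
    obtain ⟨w, rfl⟩ := Ideal.mem_span_singleton.1 hj
    -- `l * u` is congruent to `l * h * w` modulo `I`, and `l` can be cancelled.
    have hw : u - h * w ∈ I := hregl _ (by
      have : l * (u - h * w) = i := by rw [mul_sub, ← e]; ring
      rwa [this])
    have hwsoc : IsSocleElement (I ⊔ Ideal.span {l}) w := fun i => by
      rw [← key]
      have : h * (X i * w) = X i * u - X i * (u - h * w) := by ring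
      rw [this]
      exact sub_mem (hu i) (Ideal.mem_sup_left (Ideal.mul_mem_left _ _ hw))
    obtain ⟨c, hc⟩ := hspan w hwsoc
    refine ⟨c, ?_⟩
    have : u - C c * (h * s) = (u - h * w) + h * (w - C c * s) := by ring
    rw [this]
    exact add_mem (Ideal.mem_sup_left hw) ((key _).2 hc)

end Socle

/-! ### Elimination of a linear form -/

section Elimination

open RingTheory.Sequence MvPolynomial

variable {F : Type*} [Field F] {n : ℕ}

/-- The substitution that solves `l = 0` for a variable occurring in the linear form `l`. -/
theorem exists_elimination {l : MvPolynomial (Fin (n + 1)) F} (hl : l.IsHomogeneous 1)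
    (h0 : l ≠ 0) : ∃ π : MvPolynomial (Fin (n + 1)) F →ₐ[F] MvPolynomial (Fin n) F,
      RingHom.ker π = Ideal.ofList [l] ∧ (∀ i, (π (X i)).IsHomogeneous 1) ∧
      ∃ e : Fin n → Fin (n + 1), ∀ j, π (X (e j)) = X j := by
  have hmem : l ∈ Submodule.span F (Set.range (X : Fin (n + 1) → MvPolynomial _ F)) := by
    rw [← homogeneousSubmodule_one_eq_span_X]
    exact hl
  obtain ⟨c, hc⟩ := (Submodule.mem_span_range_iff_exists_fun F).1 hmem
  obtain ⟨i₀, hi₀⟩ : ∃ i, c i ≠ 0 := by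
    by_contra! h
    exact h0 (by rw [← hc]; simp [h])
  rw [Fin.sum_univ_succAbove _ i₀] at hc
  let r : MvPolynomial (Fin n) F := -((c i₀)⁻¹ • ∑ j, c (i₀.succAbove j) • X j)
  let π : MvPolynomial (Fin (n + 1)) F →ₐ[F] MvPolynomial (Fin n) F :=
    aeval (i₀.insertNth (α := fun _ => MvPolynomial (Fin n) F) r X)
  let ι : MvPolynomial (Fin n) F →ₐ[F] MvPolynomial (Fin (n + 1)) F :=
    aeval fun j => X (i₀.succAbove j)
  have hπ₀ : π (X i₀) = r := by simp [π]
  have hπ : ∀ j, π (X (i₀.succAbove j)) = X j := fun j => by simp [π]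
  have hr : r.IsHomogeneous 1 := by
    rw [← mem_homogeneousSubmodule]
    exact neg_mem (Submodule.smul_mem _ _ (sum_mem fun j _ =>
      Submodule.smul_mem _ _ (isHomogeneous_X _ _)))
  have hπl : π l = 0 := by
    rw [← hc, map_add, map_smul, hπ₀, map_sum]
    simp only [map_smul, hπ, r, smul_neg, smul_inv_smul₀ hi₀, neg_add_cancel]
  have hιr : ι r = X i₀ - (c i₀)⁻¹ • l := by
    rw [← hc, smul_add, inv_smul_smul₀ hi₀]
    simp [r, ι]
  -- Modulo `l`, the composite of `π` with its section `ι` is the identity.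
  have hsec : (Ideal.Quotient.mkₐ F (Ideal.span {l})).comp (ι.comp π) =
      Ideal.Quotient.mkₐ F (Ideal.span {l}) := by
    ext i
    simp only [AlgHom.comp_apply, Ideal.Quotient.mkₐ_eq_mk]
    rw [Ideal.Quotient.eq]
    rcases eq_or_ne i i₀ with rfl | hi
    · rw [hπ₀, hιr, sub_sub_cancel_left, smul_eq_C_mul]
      exact neg_mem (Ideal.mul_mem_left _ _ (Ideal.mem_span_singleton_self _))
    · obtain ⟨j, rfl⟩ := Fin.exists_succAbove_eq hi
      rw [hπ]
      simp [ι]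
  refine ⟨π, ?_, fun i => ?_, i₀.succAbove, hπ⟩
  · rw [Ideal.ofList_singleton]
    apply le_antisymm
    · intro u hu
      have h := DFunLike.congr_fun hsec u
      have hu' : π u = 0 := hu
      rw [AlgHom.comp_apply, AlgHom.comp_apply, hu', map_zero, map_zero] at h
      exact Ideal.Quotient.eq_zero_iff_mem.1 h.symm
    · rw [Ideal.span_singleton_le_iff_mem]
      exact hπl
  · rcases eq_or_ne i i₀ with rfl | hi
    · rwa [hπ₀]
    · obtain ⟨j, rfl⟩ := Fin.exists_succAbove_eq hi
      rw [hπ]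
      exact isHomogeneous_X _ _

/-- A linear form in a regular sequence can be eliminated together with one variable. -/
theorem exists_isSocleEmbedding_of_linear {l : MvPolynomial (Fin (n + 1)) F}
    (hl : l.IsHomogeneous 1) {rs : List (MvPolynomial (Fin (n + 1)) F)}
    (h : IsWeaklyRegular (MvPolynomial (Fin (n + 1)) F) (l :: rs)) :
    ∃ π : MvPolynomial (Fin (n + 1)) F →ₐ[F] MvPolynomial (Fin n) F,
      IsWeaklyRegular (MvPolynomial (Fin n) F) (rs.map π) ∧
      IsSocleEmbedding (Ideal.ofList (l :: rs)) (Ideal.ofList (rs.map π)) π := by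
  have h0 : l ≠ 0 := by
    rintro rfl
    have h1 := ((isWeaklyRegular_cons_iff _ _ _).1 h).1
    exact one_ne_zero (h1 (a₁ := 1) (a₂ := 0) (by simp))
  obtain ⟨π, hker, hhom, e, he⟩ := exists_elimination hl h0
  have hsurj : Function.Surjective π := fun v => ⟨rename e v, by
    have : (π.comp (rename e)) = AlgHom.id F _ := by
      ext j
      simp [he]
    exact DFunLike.congr_fun this v⟩
  have hmem : ∀ u, π u ∈ Ideal.ofList (rs.map π) ↔ u ∈ Ideal.ofList (l :: rs) :=
    map_mem_ofList_map_iff (π := π.toRingHom) hsurj hker rs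
  have hreg : IsWeaklyRegular (MvPolynomial (Fin n) F) (rs.map π) :=
    isWeaklyRegular_map_of_ker (π := π.toRingHom) hsurj hker h
  refine ⟨π, hreg, hhom, hmem, fun u hu j => ?_, fun v hv => ?_⟩
  · rw [← he, ← map_mul, hmem]
    exact hu _
  · obtain ⟨u, rfl⟩ := hsurj v
    refine ⟨u, fun i => ?_, by simp⟩
    rw [← hmem, map_mul]
    exact hv.mul_mem (IsForm.mem_idealOfVars ⟨1, one_pos, hhom i⟩)

end Elimination

/-! ### Splitting off a quadric -/

section Splitting

open RingTheory.Sequence MvPolynomial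

variable {F : Type*} [Field F] {n : ℕ}

theorem finSuccEquiv_rename_succ (u : MvPolynomial (Fin n) F) :
    finSuccEquiv F n (rename Fin.succ u) = Polynomial.C u := by
  have : (finSuccEquiv F n).toAlgHom.comp (rename Fin.succ) = Polynomial.CAlgHom := by
    ext j
    simp [finSuccEquiv_X_succ]
  exact DFunLike.congr_fun this u

/-- Adjoining a square root `y` of `q` and replacing `q * g` by `y * g`. An element `u` of the
socle modulo `q * g` satisfies `q * u = 0`, hence is a multiple of `g` and is killed by `y`. -/
theorem isSocleEmbedding_rename_succ {q g : MvPolynomial (Fin n) F} (hq : IsForm q)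
    {rs : List (MvPolynomial (Fin n) F)}
    (h : IsWeaklyRegular (MvPolynomial (Fin n) F) (rs ++ [q * g])) :
    IsWeaklyRegular (MvPolynomial (Fin (n + 1)) F) (rs.map (rename Fin.succ) ++
        [X 0 ^ 2 - rename Fin.succ q] ++ [X 0 * rename Fin.succ g]) ∧
      IsSocleEmbedding (Ideal.ofList (rs ++ [q * g])) (Ideal.ofList (rs.map (rename Fin.succ) ++
        [X 0 ^ 2 - rename Fin.succ q] ++ [X 0 * rename Fin.succ g])) (rename Fin.succ) := by
  set e := finSuccEquiv F n
  have hsymm : ∀ u, e.symm (Polynomial.C u) = rename Fin.succ u := fun u => by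
    rw [AlgEquiv.symm_apply_eq, finSuccEquiv_rename_succ]
  have hX : e.symm Polynomial.X = X 0 := by
    rw [AlgEquiv.symm_apply_eq, finSuccEquiv_X_zero]
  let ε : Polynomial (MvPolynomial (Fin n) F) →+* MvPolynomial (Fin (n + 1)) F :=
    e.symm.toRingEquiv.toRingHom
  have hε : ∀ p, ε p = e.symm p := fun _ => rfl
  have hlist : (rs.map Polynomial.C ++ [Polynomial.X ^ 2 - Polynomial.C q] ++
      [Polynomial.X * Polynomial.C g]).map ε = rs.map (rename Fin.succ) ++
        [X 0 ^ 2 - rename Fin.succ q] ++ [X 0 * rename Fin.succ g] := by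
    simp only [List.map_append, List.map_map, List.map_cons, List.map_nil, Function.comp_def,
      map_sub, map_mul, map_pow, hε, hsymm, hX]
  have hsurj : Function.Surjective ε := e.symm.surjective
  have hker : RingHom.ker ε = Ideal.ofList [] := by
    rw [Ideal.ofList_nil, RingHom.ker_eq_bot_iff_eq_zero]
    exact fun x hx => (map_eq_zero_iff e.symm e.symm.injective).1 hx
  have hreg := isWeaklyRegular_sq_sub_C_X_mul h
  rw [← hlist]
  refine ⟨isWeaklyRegular_map_of_ker hsurj hker hreg, ?_⟩
  rw [isWeaklyRegular_concat_iff] at h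
  obtain ⟨-, hqg⟩ := h
  set I := Ideal.ofList rs
  set J := Ideal.ofList ((rs.map Polynomial.C ++ [Polynomial.X ^ 2 - Polynomial.C q] ++
      [Polynomial.X * Polynomial.C g]).map ε) with hJ
  have hI : Ideal.ofList (rs ++ [q * g]) = I ⊔ Ideal.span {q * g} := by
    rw [Ideal.ofList_append, Ideal.ofList_singleton]
  have hmem : ∀ a b, rename Fin.succ a + rename Fin.succ b * X 0 ∈ J ↔
      a ∈ I ⊔ Ideal.span {q * g} ∧ b ∈ I ⊔ Ideal.span {g} := by
    intro a b
    rw [← linear_mem_sup_span_X_mul_iff, ← hsymm, ← hsymm, ← hX, ← map_mul, ← map_add]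
    refine (map_mem_ofList_map_iff hsurj hker _ _).trans ?_
    rw [List.nil_append, Ideal.ofList_append, Ideal.ofList_append, Ideal.ofList_singleton,
      Ideal.ofList_singleton, Ideal.map_ofList]
  have hmem0 : ∀ a, rename Fin.succ a ∈ J ↔ a ∈ I ⊔ Ideal.span {q * g} := by
    intro a
    simpa using hmem a 0
  have hmem1 : ∀ b, rename Fin.succ b * X 0 ∈ J ↔ b ∈ I ⊔ Ideal.span {g} := by
    intro b
    simpa using hmem 0 b
  have hsq : (X 0 ^ 2 - rename Fin.succ q : MvPolynomial (Fin (n + 1)) F) ∈ J := by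
    rw [hJ, hlist]
    exact Ideal.subset_span (by simp)
  have hcancel : ∀ u, q * u ∈ I ⊔ Ideal.span {q * g} → u ∈ I ⊔ Ideal.span {g} := by
    intro u hu
    obtain ⟨i, hi, j, hj, e⟩ := Submodule.mem_sup.1 hu
    obtain ⟨t, rfl⟩ := Ideal.mem_span_singleton.1 hj
    have hut : u - g * t ∈ I := hqg _ (by
      have : q * g * (u - g * t) = g * i := by rw [eq_sub_of_add_eq e]; ring
      rw [this]
      exact Ideal.mul_mem_left _ _ hi)
    exact Submodule.mem_sup.2 ⟨_, hut, g * t,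
      Ideal.mul_mem_right _ _ (Ideal.mem_span_singleton_self _), by ring⟩
  rw [hI]
  refine ⟨fun i => ?_, hmem0, fun u hu i => ?_, fun v hv => ?_⟩
  · rw [rename_X]
    exact isHomogeneous_X _ _
  · refine Fin.cases ?_ (fun j => ?_) i
    · rw [mul_comm, hmem1]
      exact hcancel u (hu.mul_mem hq.mem_idealOfVars)
    · rw [← rename_X, ← map_mul, hmem0]
      exact hu j
  · obtain ⟨a, b, hab⟩ := exists_linear_sub_mem_span q (e v)
    obtain ⟨t, ht⟩ := Ideal.mem_span_singleton.1 hab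
    have hv' : v = rename Fin.succ a + rename Fin.succ b * X 0 +
        (X 0 ^ 2 - rename Fin.succ q) * e.symm t := by
      have := congrArg e.symm (eq_add_of_sub_eq' ht)
      simpa only [AlgEquiv.symm_apply_apply, map_add, map_mul, map_sub, map_pow, hsymm, hX]
        using this
    -- The products of `v` with the variables, in normal form modulo `X 0 ^ 2 - q`.
    have hXv : ∀ j, X j * a ∈ I ⊔ Ideal.span {q * g} := by
      intro j
      refine ((hmem (X j * a) (X j * b)).1 ?_).1
      have := sub_mem (hv j.succ) (Ideal.mul_mem_left J (X j.succ * e.symm t) hsq)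
      convert this using 1
      rw [hv']
      simp only [map_mul, rename_X]
      ring
    have hb : b ∈ I ⊔ Ideal.span {g} := by
      refine hcancel b ((hmem (q * b) a).1 ?_).1
      have := sub_mem (hv 0)
        (Ideal.mul_mem_left J (X 0 * e.symm t + rename Fin.succ b) hsq)
      convert this using 1
      rw [hv']
      simp only [map_mul]
      ring
    refine ⟨a, hXv, ?_⟩
    have : v - rename Fin.succ a = rename Fin.succ b * X 0 +
        e.symm t * (X 0 ^ 2 - rename Fin.succ q) := by
      rw [hv']
      ring
    rw [this]
    exact add_mem ((hmem1 b).2 hb) (Ideal.mul_mem_left _ _ hsq)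

end Splitting

/-! ### Induction on the number of linear factors -/

section Induction

open RingTheory.Sequence MvPolynomial

variable {F : Type*} [Field F]

theorem isForm_prod {n : ℕ} {L : List (MvPolynomial (Fin n) F)} (hne : L ≠ [])
    (hL : ∀ l ∈ L, l.IsHomogeneous 1) : IsForm L.prod := by
  induction L with
  | nil => exact absurd rfl hne
  | cons l L ih =>
    have hl : IsForm l := ⟨1, one_pos, hL l (by simp)⟩
    rcases eq_or_ne L [] with rfl | hL'
    · simpa using hl
    · rw [List.prod_cons]
      exact hl.mul (ih hL' fun l' hl' => hL l' (by simp [hl']))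

/-- A non-empty list of linear forms. -/
def IsLinearList {n : ℕ} (L : List (MvPolynomial (Fin n) F)) : Prop :=
  L ≠ [] ∧ ∀ l ∈ L, l.IsHomogeneous 1

theorem IsLinearList.map {n m : ℕ} {ψ : MvPolynomial (Fin n) F →ₐ[F] MvPolynomial (Fin m) F}
    (hψ : ∀ i, (ψ (X i)).IsHomogeneous 1) {L : List (MvPolynomial (Fin n) F)}
    (hL : IsLinearList L) : IsLinearList (L.map ψ) := by
  refine ⟨by simpa using hL.1, fun l hl => ?_⟩
  obtain ⟨l, hl', rfl⟩ := List.mem_map.1 hl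
  exact isHomogeneous_map hψ (hL.2 l hl')

theorem map_prod_map {n m : ℕ} (ψ : MvPolynomial (Fin n) F →ₐ[F] MvPolynomial (Fin m) F)
    (ls : List (List (MvPolynomial (Fin n) F))) :
    (ls.map (List.map ψ)).map List.prod = (ls.map List.prod).map ψ := by
  simp [Function.comp_def, map_list_prod]

/-- A sequence is encoded by the lists `L ∈ ls` of the linear factors of its members; the induction
is on the total number `N` of these factors. -/
theorem hasSimpleSocle_of_products (N : ℕ) : ∀ (n : ℕ) (ls : List (List (MvPolynomial (Fin n) F))),
    (ls.map List.length).sum = N → ls.length = n → (∀ L ∈ ls, IsLinearList L) →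
    IsWeaklyRegular (MvPolynomial (Fin n) F) (ls.map List.prod) →
    HasSimpleSocle (Ideal.ofList (ls.map List.prod)) := by
  induction N using Nat.strong_induction_on with
  | _ N ih =>
  rintro n (_ | ⟨_ | ⟨l, h⟩, ls⟩) hN hn hls hreg
  · obtain rfl : 0 = n := hn
    refine ⟨1, by simp, fun i => i.elim0, fun u _ => ⟨u.coeff 0, ?_⟩⟩
    rw [mul_one, ← eq_C_of_isEmpty u, sub_self]
    exact zero_mem _
  · exact absurd rfl (hls [] (by simp)).1
  · have hl : l.IsHomogeneous 1 := (hls (l :: h) (by simp)).2 l (by simp)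
    have hls' : ∀ L ∈ ls, IsLinearList L := fun L hL => hls L (by simp [hL])
    rcases eq_or_ne h [] with rfl | hh
    · obtain ⟨k, rfl⟩ : ∃ k, n = k + 1 := ⟨ls.length, by simpa using hn.symm⟩
      rw [List.map_cons, List.prod_singleton] at hreg ⊢
      obtain ⟨π, hπ, hemb⟩ := exists_isSocleEmbedding_of_linear hl hreg
      refine hemb.hasSimpleSocle ?_
      rw [← map_prod_map] at hπ ⊢
      refine ih (ls.map List.length).sum ?_ k _ ?_ (by simpa using hn) ?_ hπ
      · rw [← hN]
        simp
      · simp [Function.comp_def]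
      · intro L hL
        obtain ⟨L, hL', rfl⟩ := List.mem_map.1 hL
        exact (hls' L hL').map hemb.homogeneous
    · have hforms : ∀ r ∈ (((l :: h) :: ls).map List.prod), IsForm r := by
        intro r hr
        obtain ⟨L, hL, rfl⟩ := List.mem_map.1 hr
        exact isForm_prod (hls L hL).1 (hls L hL).2
      have hforms' : ∀ r ∈ ls.map List.prod ++ [l], IsForm r := by
        intro r hr
        rcases List.mem_append.1 hr with hr | hr
        · exact hforms r (by rw [List.map_cons]; exact List.mem_cons_of_mem _ hr)
        · rw [List.mem_singleton.1 hr]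
          exact ⟨1, one_pos, hl⟩
      have hreg' := isWeaklyRegular_perm hforms hreg (List.perm_append_singleton _ _).symm
      rw [isWeaklyRegular_concat_iff, List.prod_cons] at hreg'
      have hregl : IsWeaklyRegular (MvPolynomial (Fin n) F) (ls.map List.prod ++ [l]) := by
        rw [isWeaklyRegular_concat_iff]
        refine ⟨hreg'.1, fun x hx => hreg'.2 x ?_⟩
        rw [mul_comm l, mul_assoc]
        exact Ideal.mul_mem_left _ _ hx
      have hsimple := ih (([l] :: ls).map List.length).sum (by
          rw [← hN]
          simpa [List.length_pos_iff] using hh) n ([l] :: ls) rfl (by simpa using hn)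
        (by
          intro L hL
          rcases List.mem_cons.1 hL with rfl | hL
          · exact ⟨by simp, by simpa using hl⟩
          · exact hls' L hL)
        (by
          rw [List.map_cons, List.prod_singleton]
          exact isWeaklyRegular_perm hforms' hregl (List.perm_append_singleton _ _))
      rw [List.map_cons, List.prod_singleton, Ideal.ofList_cons, sup_comm] at hsimple
      rw [List.map_cons, List.prod_cons, Ideal.ofList_cons, sup_comm]
      exact hsimple.mul (IsForm.mem_idealOfVars ⟨1, one_pos, hl⟩) hreg'.2

/-- The sequence consists of the products of the lists `L ∈ ls` of linear forms that are still to be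
split, and of the quadrics `qs`; the induction is on the total number `N` of linear factors. -/
theorem exists_quadratic_isSocleEmbedding (N : ℕ) :
    ∀ (n : ℕ) (ls : List (List (MvPolynomial (Fin n) F))) (qs : List (MvPolynomial (Fin n) F)),
    (ls.map List.length).sum = N → ls.length + qs.length = n → (∀ L ∈ ls, IsLinearList L) →
    (∀ q ∈ qs, q.IsHomogeneous 2) →
    IsWeaklyRegular (MvPolynomial (Fin n) F) (ls.map List.prod ++ qs) →
    ∃ (m : ℕ) (gs : List (MvPolynomial (Fin m) F)), gs.length = m ∧
      (∀ g ∈ gs, g.IsHomogeneous 2) ∧ IsWeaklyRegular (MvPolynomial (Fin m) F) gs ∧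
      ∃ ψ : MvPolynomial (Fin n) F →ₐ[F] MvPolynomial (Fin m) F,
        IsSocleEmbedding (Ideal.ofList (ls.map List.prod ++ qs)) (Ideal.ofList gs) ψ := by
  induction N using Nat.strong_induction_on with
  | _ N ih =>
  intro n ls qs hN hn hls hqs hreg
  have hforms : ∀ r ∈ ls.map List.prod ++ qs, IsForm r := by
    intro r hr
    rcases List.mem_append.1 hr with hr | hr
    · obtain ⟨L, hL, rfl⟩ := List.mem_map.1 hr
      exact isForm_prod (hls L hL).1 (hls L hL).2
    · exact ⟨2, two_pos, hqs r hr⟩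
  rcases ls with _ | ⟨_ | ⟨l₁, _ | ⟨l₂, L⟩⟩, ls⟩
  · exact ⟨n, qs, by simpa using hn, hqs, by simpa using hreg, AlgHom.id F _, .refl _⟩
  · exact absurd rfl (hls [] (by simp)).1
  · obtain ⟨k, rfl⟩ : ∃ k, n = k + 1 := ⟨ls.length + qs.length, by simp at hn; omega⟩
    have hl : l₁.IsHomogeneous 1 := (hls [l₁] (by simp)).2 l₁ (by simp)
    rw [List.map_cons, List.prod_singleton, List.cons_append] at hreg ⊢
    obtain ⟨π, hπ, hemb⟩ := exists_isSocleEmbedding_of_linear hl hreg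
    rw [List.map_append, ← map_prod_map] at hπ hemb
    obtain ⟨m, gs, hm, hgs, hgreg, ψ, hψ⟩ := ih (ls.map List.length).sum (by rw [← hN]; simp) k
      (ls.map (List.map π)) (qs.map π) (by simp [Function.comp_def]) (by simp at hn ⊢; omega)
      (by
        intro L hL
        obtain ⟨L, hL', rfl⟩ := List.mem_map.1 hL
        exact (hls L (by simp [hL'])).map hemb.homogeneous)
      (by
        intro q hq
        obtain ⟨q, hq', rfl⟩ := List.mem_map.1 hq
        exact isHomogeneous_map hemb.homogeneous (hqs q hq'))
      hπ
    exact ⟨m, gs, hm, hgs, hgreg, ψ.comp π, hemb.trans hψ⟩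
  · have hl₁ : l₁.IsHomogeneous 1 := (hls (l₁ :: l₂ :: L) (by simp)).2 l₁ (by simp)
    have hl₂ : l₂.IsHomogeneous 1 := (hls (l₁ :: l₂ :: L) (by simp)).2 l₂ (by simp)
    have hL : ∀ l ∈ L, l.IsHomogeneous 1 := fun l hl =>
      (hls (l₁ :: l₂ :: L) (by simp)).2 l (by simp [hl])
    have hq : (l₁ * l₂).IsHomogeneous 2 := hl₁.mul hl₂
    have hls' : ∀ L ∈ ls, IsLinearList L := fun L hL => hls L (by simp [hL])
    rw [List.map_cons, List.prod_cons, List.prod_cons, ← mul_assoc, List.cons_append]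
      at hreg hforms ⊢
    rcases eq_or_ne L [] with rfl | hL0
    · rw [List.prod_nil, mul_one] at hreg hforms ⊢
      have hp : (l₁ * l₂ :: (ls.map List.prod ++ qs)).Perm
          (ls.map List.prod ++ (l₁ * l₂ :: qs)) := List.perm_middle.symm
      rw [ofList_perm hp]
      refine ih (ls.map List.length).sum (by rw [← hN]; simp) n ls (l₁ * l₂ :: qs) rfl
        (by simp at hn ⊢; omega) hls' ?_ (isWeaklyRegular_perm hforms hreg hp)
      intro q hq'
      rcases List.mem_cons.1 hq' with rfl | hq'
      · exact hq
      · exact hqs q hq'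
    · have hp := (List.perm_append_singleton (l₁ * l₂ * L.prod) (ls.map List.prod ++ qs)).symm
      obtain ⟨hreg', hemb⟩ := isSocleEmbedding_rename_succ ⟨2, two_pos, hq⟩
        (isWeaklyRegular_perm hforms hreg hp)
      rw [← ofList_perm hp] at hemb
      set ι : MvPolynomial (Fin n) F →ₐ[F] MvPolynomial (Fin (n + 1)) F := rename Fin.succ
      have hιhom := hemb.homogeneous
      have hp' : ((ls.map List.prod ++ qs).map ι ++ [X 0 ^ 2 - ι (l₁ * l₂)] ++
          [X 0 * ι L.prod]).Perm ((((X 0 :: L.map ι) :: ls.map (List.map ι)).map List.prod) ++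
            ((X 0 ^ 2 - ι (l₁ * l₂)) :: qs.map ι)) := by
        rw [List.map_cons, List.prod_cons, map_prod_map, ← map_list_prod, List.map_append,
          List.cons_append]
        refine (List.perm_append_singleton _ _).trans (List.Perm.cons _ ?_)
        exact (List.perm_append_singleton _ _).trans List.perm_middle.symm
      have hlin : ∀ L' ∈ (X 0 :: L.map ι) :: ls.map (List.map ι), IsLinearList L' := by
        intro L' hL'
        rcases List.mem_cons.1 hL' with rfl | hL'
        · refine ⟨by simp, fun l hl => ?_⟩
          rcases List.mem_cons.1 hl with rfl | hl
          · exact isHomogeneous_X _ _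
          · obtain ⟨l, hl', rfl⟩ := List.mem_map.1 hl
            exact isHomogeneous_map hιhom (hL l hl')
        · obtain ⟨L, hL, rfl⟩ := List.mem_map.1 hL'
          exact (hls' L hL).map hιhom
      have hquad : ∀ q ∈ (X 0 ^ 2 - ι (l₁ * l₂)) :: qs.map ι, q.IsHomogeneous 2 := by
        intro q hq'
        rcases List.mem_cons.1 hq' with rfl | hq'
        · exact ((isHomogeneous_X F 0).pow 2).sub (isHomogeneous_map hιhom hq)
        · obtain ⟨p, hp, rfl⟩ := List.mem_map.1 hq'
          exact isHomogeneous_map hιhom (hqs p hp)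
      have hforms' : ∀ r ∈ (ls.map List.prod ++ qs).map ι ++ [X 0 ^ 2 - ι (l₁ * l₂)] ++
          [X 0 * ι L.prod], IsForm r := by
        intro r hr
        rcases List.mem_append.1 (hp'.mem_iff.1 hr) with hr | hr
        · obtain ⟨L', hL', rfl⟩ := List.mem_map.1 hr
          exact isForm_prod (hlin L' hL').1 (hlin L' hL').2
        · exact ⟨2, two_pos, hquad r hr⟩
      obtain ⟨m, gs, hm, hgs, hgreg, ψ, hψ⟩ := ih
        (((X 0 :: L.map ι) :: ls.map (List.map ι)).map List.length).sum
        (by rw [← hN]; simp [Function.comp_def]) (n + 1) _ _ rfl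
        (by simp at hn ⊢; omega) hlin hquad (isWeaklyRegular_perm hforms' hreg' hp')
      rw [← ofList_perm hp'] at hψ
      exact ⟨m, gs, hm, hgs, hgreg, ψ.comp ι, hemb.trans hψ⟩

end Induction

/-! ### Passage to the quotient algebras -/

section Quotient

open RingTheory.Sequence MvPolynomial

variable {F : Type*} [Field F] {n m : ℕ}

theorem mk_mem_socle_iff (f : Fin n → MvPolynomial (Fin n) F) (u : MvPolynomial (Fin n) F) :
    (Ideal.Quotient.mk (Ideal.span (Set.range f)) u ∈ socle f) ↔
      IsSocleElement (Ideal.span (Set.range f)) u := by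
  rw [socle, Submodule.restrictScalars_mem, maxIdeal, Submodule.mem_annihilator_span]
  simp only [Subtype.forall, Set.forall_mem_range, smul_eq_mul, IsSocleElement]
  refine forall_congr' fun i => ?_
  rw [← map_mul, Ideal.Quotient.eq_zero_iff_mem, mul_comm]

theorem isSocleGenerator_mk (f : Fin n → MvPolynomial (Fin n) F) {s : MvPolynomial (Fin n) F}
    (hs : s ∉ Ideal.span (Set.range f)) (hsoc : IsSocleElement (Ideal.span (Set.range f)) s)
    (hspan : ∀ u, IsSocleElement (Ideal.span (Set.range f)) u →
      ∃ c : F, u - C c * s ∈ Ideal.span (Set.range f)) :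
    IsSocleGenerator f (Ideal.Quotient.mk _ s) := by
  refine ⟨fun h => hs (Ideal.Quotient.eq_zero_iff_mem.1 h), le_antisymm ?_ ?_⟩
  · intro z hz
    obtain ⟨u, rfl⟩ := Ideal.Quotient.mk_surjective z
    obtain ⟨c, hc⟩ := hspan u ((mk_mem_socle_iff f u).1 hz)
    refine Submodule.mem_span_singleton.2 ⟨c, ?_⟩
    rw [← Ideal.Quotient.eq, ← smul_eq_C_mul] at hc
    exact hc.symm
  · rw [Submodule.span_singleton_le_iff_mem]
    exact (mk_mem_socle_iff f s).2 hsoc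

theorem span_range_eq_ofList (f : Fin n → MvPolynomial (Fin n) F) :
    Ideal.span (Set.range f) = Ideal.ofList (List.ofFn f) := by
  simp only [Ideal.ofList, List.mem_ofFn']
  rfl

/-- A one-dimensional socle is needed here only for the source, as that of the target is its image. -/
theorem IsSocleEmbedding.exists_isEmbedding {f : Fin n → MvPolynomial (Fin n) F}
    {g : Fin m → MvPolynomial (Fin m) F}
    {ψ : MvPolynomial (Fin n) F →ₐ[F] MvPolynomial (Fin m) F}
    (hψ : IsSocleEmbedding (Ideal.span (Set.range f)) (Ideal.span (Set.range g)) ψ)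
    (hf : HasSimpleSocle (Ideal.span (Set.range f))) :
    ∃ φ : CIQuotient f →ₐ[F] CIQuotient g, IsEmbedding φ := by
  refine ⟨Ideal.quotientMapₐ _ ψ fun u hu => (hψ.mem_iff u).2 hu, ?_, ?_⟩
  · rintro d _ ⟨p, hp, rfl⟩
    exact ⟨ψ p, isHomogeneous_map hψ.homogeneous hp, rfl⟩
  · obtain ⟨s, hs, hsoc, hspan⟩ := hf
    refine ⟨Ideal.Quotient.mk _ s, isSocleGenerator_mk f hs hsoc hspan,
      isSocleGenerator_mk g (s := ψ s) (fun h => hs ((hψ.mem_iff s).1 h)) (hψ.socle s hsoc)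
        fun v hv => ?_⟩
    obtain ⟨u, hu, hvu⟩ := hψ.surj v hv
    obtain ⟨c, hc⟩ := hspan u hu
    refine ⟨c, ?_⟩
    have e : v - C c * ψ s = (v - ψ u) + ψ (u - C c * s) := by
      have : ψ (C c) = C c := ψ.commutes c
      rw [map_sub, map_mul, this]
      ring
    rw [e]
    exact add_mem hvu ((hψ.mem_iff _).2 hc)

theorem isQuadraticRegularSeq_get {gs : List (MvPolynomial (Fin m) F)} (hm : gs.length = m)
    (hgs : ∀ g ∈ gs, g.IsHomogeneous 2) (hreg : IsWeaklyRegular (MvPolynomial (Fin m) F) gs) :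
    ∃ g : Fin m → MvPolynomial (Fin m) F, List.ofFn g = gs ∧ IsQuadraticRegularSeq g := by
  have hg : List.ofFn (fun i : Fin m => gs.get (i.cast hm.symm)) = gs := by
    refine List.ext_get (by simp [hm]) fun i h₁ h₂ => by simp
  have hquad : ∀ i : Fin m, (gs.get (i.cast hm.symm)).IsHomogeneous 2 :=
    fun i => hgs _ (List.get_mem _ _)
  refine ⟨_, hg, ⟨fun i => ⟨2, two_pos, hquad i⟩, ?_⟩, hquad⟩
  rw [hg]
  refine ⟨hreg, fun h => ?_⟩
  rw [smul_eq_mul, Ideal.mul_top] at h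
  have hle : Ideal.ofList gs ≤ RingHom.ker (constantCoeff (σ := Fin m) (R := F)) := by
    refine Ideal.span_le.2 fun r hr => ?_
    exact (hgs r hr).coeff_eq_zero (by simp)
  have h1 : (1 : MvPolynomial (Fin m) F) ∈ RingHom.ker (constantCoeff (σ := Fin m) (R := F)) :=
    hle (h ▸ Submodule.mem_top)
  simp at h1

end Quotient

end BoldConjecture

theorem theorem1p1 {F : Type*} [Field F] (n : ℕ) (f : Fin n → MvPolynomial (Fin n) F)
    (hreg : BoldConjecture.IsHomogRegularSeq f)
    (hsplit : ∀ i, BoldConjecture.IsProductOfLinearForms (f i)) :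
    ∃ (m : ℕ) (g : Fin m → MvPolynomial (Fin m) F),
      BoldConjecture.IsQuadraticRegularSeq g ∧
      ∃ φ : BoldConjecture.CIQuotient f →ₐ[F] BoldConjecture.CIQuotient g,
        BoldConjecture.IsEmbedding φ := by
  choose N l hl hf using hsplit
  obtain ⟨ls, hlen, hlist, hls⟩ : ∃ ls : List (List (MvPolynomial (Fin n) F)),
      ls.length = n ∧ ls.map List.prod = List.ofFn f ∧
        ∀ L ∈ ls, BoldConjecture.IsLinearList L := by
    refine ⟨List.ofFn fun i => List.ofFn (l i), by simp, ?_, ?_⟩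
    · rw [List.map_ofFn]
      congr 1
      funext i
      simp [hf i, List.prod_ofFn]
    · intro L hL
      obtain ⟨i, rfl⟩ := (List.mem_ofFn' _ _).1 hL
      refine ⟨fun h => ?_, fun p hp => ?_⟩
      · -- The empty product has degree zero, unlike the members of the sequence.
        obtain ⟨d, hd, hfd⟩ := hreg.homogeneous i
        have h1 : f i = 1 := by
          rw [hf i, ← List.prod_ofFn]
          exact (congrArg List.prod h).trans List.prod_nil
        rw [h1] at hfd
        exact hd.ne (MvPolynomial.IsHomogeneous.inj_right
          (MvPolynomial.isHomogeneous_one (Fin n) F) hfd one_ne_zero)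
      · obtain ⟨j, rfl⟩ := (List.mem_ofFn' _ _).1 hp
        exact hl i j
  have hweak := hreg.regular.toIsWeaklyRegular
  rw [← hlist] at hweak
  have hsimple := BoldConjecture.hasSimpleSocle_of_products _ n ls rfl hlen hls hweak
  obtain ⟨m, gs, hm, hgs, hgreg, ψ, hψ⟩ :=
    BoldConjecture.exists_quadratic_isSocleEmbedding _ n ls [] rfl (by simpa using hlen) hls
      (by simp) (by simpa using hweak)
  obtain ⟨g, rfl, hg⟩ := BoldConjecture.isQuadraticRegularSeq_get hm hgs hgreg
  rw [List.append_nil, hlist, ← BoldConjecture.span_range_eq_ofList,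
    ← BoldConjecture.span_range_eq_ofList] at hψ
  rw [hlist, ← BoldConjecture.span_range_eq_ofList] at hsimple
  exact ⟨m, g, hg, hψ.exists_isEmbedding hsimple⟩
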